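/- Let $k\ge 1$ be an integer and let $\beta_0,\beta_1,\ldots,\beta_{2k-2},\beta_{2k}$ be real numbers with $\beta_0>0$. For $x\in\mathbb R$ put $\beta(x):=(\beta_0,\beta_1,\ldots,\beta_{2k-2},x,\beta_{2k})$, and let $\widetilde\beta:=(\beta_0,\ldots,\beta_{2k-2})$ and $\widehat\beta:=(\beta_0,\ldots,\beta_{2k-4})$ (empty if $k=1$). For a real sequence $\gamma=(\gamma_0,\ldots,\gamma_{2m})$ let $A_\gamma:=(\gamma_{i+j})_{i,j=0}^m$ be its Hankel matrix, with columns $\mathbf v_0,\ldots,\mathbf v_m$. Let $\operatorname{Rank}\gamma:=m+1$ if $A_\gamma$ is nonsingular, and $\operatorname{Rank}\gamma:=\min\{i:\mathbf v_i\in\operatorname{span}\{\mathbf v_0,\ldots,\mathbf v_{i-1}\}\}$ if $A_\gamma$ is singular; for a matrix, $\operatorname{Rank}$ is the usual rank. A representing measure for $\gamma$ is a positive Borel measure $\mu$ on $\mathbb R$ such that $\int |t|^i\,d\mu<\infty$ and $\int t^i\,d\mu(t)=\gamma_i$ for $0\le i\le 2m$; it is $r$-atomic if it is a sum of point masses with positive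 densities at exactly $r$ distinct points. Let $A_{\beta(x)}$, with $x$ unspecified, be the partial symmetric $(k+1)\times(k+1)$ Hankel matrix of $\beta(x)$; it is partially positive semidefinite if all its fully specified principal submatrices are positive semidefinite. For $k\ge2$ let $v:=(\beta_k,\ldots,\beta_{2k-2})$ and $$\widetilde A:=\begin{pmatrix}A_{\widehat\beta}&v^T\\ v&\beta_{2k}\end{pmatrix}.$$ Then the following statements are equivalent: 1. There exist $x_0\in\mathbb R$ and a representing measure for $\beta(x_0)$. 2. There exist $x_0\in\mathbb R$ and a $(\operatorname{Rank}\widetilde\beta)$-atomic representing measure for $\beta(x_0)$. 3. $A_{\beta(x)}$ is partially positive semidefinite, and either $k=1$, or $k>1$ and one of the following holds: $A_{\widetilde\beta}\succ0$ (positive definite), or $\operatorname{Rank}A_{\widehat\beta}=\operatorname{Rank}A_{\widetilde\beta}=\operatorname{Rank}\widetilde A$. -/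

import Mathlib

open MeasureTheory

namespace HamburgerGap

/-- The `n × n` Hankel matrix `(β_{i+j})`, `0 ≤ i, j < n`, of a sequence `β`. It only involves the
entries `β_0, …, β_{2n-2}`: for a sequence `β = (β_0, …, β_{2m})` of degree `2m`, the matrix `A_β`
is `hankel (m + 1) β`. -/
def hankel {R : Type*} (n : ℕ) (β : ℕ → R) : Matrix (Fin n) (Fin n) R :=
  Matrix.of fun i j => β ((i : ℕ) + (j : ℕ))

/-- The rank of the *sequence* `(β_0, …, β_{2n-2})` with `n × n` Hankel matrix `A`: it is `n` if `A`
is nonsingular, and otherwise the least `i` such that the column `v_i` of `A` lies in the span of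
the preceding columns `v_0, …, v_{i-1}`. -/
noncomputable def seqRank (n : ℕ) (β : ℕ → ℝ) : ℕ :=
  open Classical in
  if IsUnit (hankel n β) then n
  else sInf {i : ℕ | ∃ hi : i < n,
    (hankel n β).col ⟨i, hi⟩ ∈
      Submodule.span ℝ ((hankel n β).col '' {j : Fin n | (j : ℕ) < i})}

/-- A partial matrix has entries in `Option ℝ`, where `none` marks an unspecified entry. It is
partially positive semidefinite if it is symmetric (the pattern as well as the values) and each of
its fully specified principal submatrices is positive semidefinite. -/
structure PartiallyPosSemidef {n : Type*} (A : Matrix n n (Option ℝ)) : Prop where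
  symm : ∀ i j, A i j = A j i
  posSemidef : ∀ (Q : Finset n) (B : Matrix Q Q ℝ),
    (∀ i j : Q, A i j = some (B i j)) → B.PosSemidef

/-- The sequence `β(x) = (β_0, …, β_{2k-2}, x, β_{2k})` with the real number `x` in place of
the entry of index `2k - 1`. -/
def fillGap (k : ℕ) (β : ℕ → ℝ) (x : ℝ) : ℕ → ℝ :=
  Function.update β (2 * k - 1) x

/-- The sequence `β(x)` with the entry of index `2k - 1` left unspecified. -/
def withGap (k : ℕ) (β : ℕ → ℝ) : ℕ → Option ℝ :=
  Function.update (fun i => some (β i)) (2 * k - 1) none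

/-- The bordered matrix with blocks `A_β̂ = (β_{i+j})`, `0 ≤ i, j ≤ k - 2`, the vector
`v = (β_k, …, β_{2k-2})` as last column and last row, and the corner `β_{2k}`. -/
def borderedHankel (k : ℕ) (β : ℕ → ℝ) :
    Matrix (Fin (k - 1) ⊕ Unit) (Fin (k - 1) ⊕ Unit) ℝ :=
  Matrix.fromBlocks (hankel (k - 1) β) (Matrix.of fun i _ => β (k + (i : ℕ)))
    (Matrix.of fun _ j => β (k + (j : ℕ))) (Matrix.of fun _ _ => β (2 * k))

/-- `μ` is a representing measure on `ℝ` for the sequence `(β_0, …, β_d)`: all moments up to order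
`d` exist and have the prescribed values. -/
def IsRepresentingMeasure (d : ℕ) (β : ℕ → ℝ) (μ : Measure ℝ) : Prop :=
  ∀ i ≤ d, Integrable (fun t : ℝ => t ^ i) μ ∧ ∫ t, t ^ i ∂μ = β i

/-- `μ` is `r`-atomic: a sum of point masses with positive densities at exactly `r` distinct
points. -/
def IsAtomicMeasure (r : ℕ) (μ : Measure ℝ) : Prop :=
  ∃ (s : Finset ℝ) (w : ℝ → ℝ), s.card = r ∧ (∀ t ∈ s, 0 < w t) ∧
    μ = ∑ t ∈ s, ENNReal.ofReal (w t) • Measure.dirac t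

end HamburgerGap

/-!
Write `L` for the functional on `ℝ[X]` with the given moments. Hankel matrices are Gram matrices of
the form `(p, q) ↦ L (p * q)`, so positivity and rank conditions become statements about `L`.

If `μ` represents `β(x₀)`, then `L (p * p) = ∫ p² ≥ 0`, which is partial positive semidefiniteness.
If the `k × k` Hankel matrix is not positive definite, some nonzero `p` of degree less than `k` has
`∫ p² = 0` and hence vanishes `μ`-almost everywhere; every power of `X` then agrees almost
everywhere with its remainder modulo `p`, of degree less than `k - 1`, which forces the rank
equalities (`IsRepresentingMeasure.exists_remainder`, `rank_hankel_eq_rank_momentMatrix_iff`).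

Conversely, both alternatives of the criterion yield `h = X ^ (k - 1) - d` and `u = X ^ k - c`,
orthogonal to all polynomials of degree less than `k - 1`, such that `L (h * h) = 0` implies
`L (u * u) = 0`. The missing moment enters `L (u * h)` linearly and can be chosen such that
`L (u * h) ^ 2 = L (u * u) * L (h * h)`; then a combination `g = u - s • h` lies in the radical of
the form on polynomials of degree at most `k` (`exists_flat_fillGap`). So the extended Hankel matrix
is positive semidefinite and flat over the `k × k` one.

A flat extension has an atomic representing measure (`exists_atomic_of_flat`). With
`r = seqRank k β`, the functional is positive on nonzero squares of polynomials of degree less than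
`r`, and there is a monic `p` of degree `r` orthogonal to all polynomials of degree less than `k`
(`seqRank_spec`). As an orthogonal polynomial, `p` has `r` distinct real roots, and Gauss quadrature
at these roots reproduces `L` in degrees less than `k + r` (`exists_quadrature`). Finally `g`
vanishes at the nodes, and reduction modulo `g` extends exactness to degree `2 * k`
(`exists_quadrature_of_flat`).
-/

namespace HamburgerGap

open Polynomial

/-! ### Gauss quadrature for functionals on polynomials -/

/-- An orthogonal polynomial of a functional that is positive on squares of lower degree has no
double root: dividing a square factor `(X - a)²` out of `p` leaves `b` with
`0 = L (p * b) = L (((X - a) * b)²)`. -/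
lemma nodup_roots_of_orthogonal (L : ℝ[X] →ₗ[ℝ] ℝ) {p : ℝ[X]} (hp : p.Monic)
    (hpos : ∀ f : ℝ[X], f ≠ 0 → f.degree < p.degree → 0 < L (f * f))
    (horth : ∀ q : ℝ[X], q.degree < p.degree → L (p * q) = 0) : p.roots.Nodup := by
  rw [Multiset.nodup_iff_count_le_one]
  intro a
  by_contra! h
  rw [count_roots] at h
  have h2 : (X - C a) ^ 2 ∣ p := (le_rootMultiplicity_iff hp.ne_zero).1 h
  obtain ⟨b, rfl⟩ := h2
  have hb : b ≠ 0 := by rintro rfl; simp at hp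
  have hd : ((X - C a) ^ 2 * b).degree = ((b.natDegree + 2 : ℕ) : WithBot ℕ) := by
    rw [degree_mul, degree_pow, degree_X_sub_C, degree_eq_natDegree hb]
    push_cast
    ring_nf
  have hd1 : ((X - C a) * b).degree = ((b.natDegree + 1 : ℕ) : WithBot ℕ) := by
    rw [degree_mul, degree_X_sub_C, degree_eq_natDegree hb]
    push_cast
    ring
  have h0 := horth b (by rw [hd, degree_eq_natDegree hb]; exact_mod_cast (by omega))
  have h1 := hpos ((X - C a) * b) (mul_ne_zero (X_sub_C_ne_zero a) hb)
    (by rw [hd, hd1]; exact_mod_cast (by omega))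
  rw [show (X - C a) ^ 2 * b * b = (X - C a) * b * ((X - C a) * b) by ring] at h0
  linarith

/-- An orthogonal polynomial of a functional that is positive on squares of lower degree has real
roots only: a pair of conjugate roots gives `p = ((X - x)² + y²) * b`, and then
`0 = L (p * b) = L (((X - x) * b)²) + y² * L (b²) > 0`. -/
lemma splits_of_orthogonal (L : ℝ[X] →ₗ[ℝ] ℝ) {p : ℝ[X]} (hp : p.Monic)
    (hpos : ∀ f : ℝ[X], f ≠ 0 → f.degree < p.degree → 0 < L (f * f))
    (horth : ∀ q : ℝ[X], q.degree < p.degree → L (p * q) = 0) : p.Splits := by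
  have key : ∀ z : ℂ, aeval z p = 0 → z.im = 0 := by
    intro z hz
    by_contra him
    obtain ⟨b, hb⟩ := quadratic_dvd_of_aeval_eq_zero_im_ne_zero p hz him
    have hu : X ^ 2 - C (2 * z.re) * X + C (‖z‖ ^ 2) = (X - C z.re) ^ 2 + C (z.im ^ 2) := by
      rw [← Complex.normSq_eq_norm_sq, Complex.normSq_apply]
      simp only [map_add, map_mul, map_pow, map_ofNat]
      ring
    rw [hu] at hb
    have hb0 : b ≠ 0 := by rintro rfl; simp [hb] at hp
    have hd : p.degree = ((b.natDegree + 2 : ℕ) : WithBot ℕ) := by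
      have h2 : ((X - C z.re) ^ 2 + C (z.im ^ 2)).degree = 2 := by
        rw [degree_add_C] <;> rw [degree_pow, degree_X_sub_C] <;> norm_num
      rw [hb, degree_mul, h2, degree_eq_natDegree hb0]
      push_cast
      ring
    have hd1 : ((X - C z.re) * b).degree = ((b.natDegree + 1 : ℕ) : WithBot ℕ) := by
      rw [degree_mul, degree_X_sub_C, degree_eq_natDegree hb0]
      push_cast
      ring
    have hbd : b.degree < p.degree := by
      rw [hd, degree_eq_natDegree hb0]; exact_mod_cast (by omega)
    have h0 := horth b hbd
    have h1 := hpos ((X - C z.re) * b) (mul_ne_zero (X_sub_C_ne_zero _) hb0)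
      (by rw [hd, hd1]; exact_mod_cast (by omega))
    have h2 := hpos b hb0 hbd
    have h3 : p * b = (X - C z.re) * b * ((X - C z.re) * b) + z.im ^ 2 • (b * b) := by
      rw [hb, smul_eq_C_mul]; ring
    rw [h3, map_add, map_smul, smul_eq_mul] at h0
    have := mul_nonneg (sq_nonneg z.im) h2.le
    linarith
  refine (IsAlgClosed.splits (p.map (algebraMap ℝ ℂ))).of_splits_map _ fun z hz => ⟨z.re, ?_⟩
  have h0 : aeval z p = 0 := by
    have := (mem_roots'.1 hz).2
    rwa [IsRoot, eval_map_algebraMap] at this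
  exact Complex.ext rfl (key z h0).symm

/-- **Gauss quadrature.** If `L` is positive on nonzero squares of polynomials of degree less than
that of the monic polynomial `p`, and `p` is `L`-orthogonal to all polynomials of degree less than
`n`, then integration against positive point masses at the roots of `p` agrees with `L` in degrees
less than `n + natDegree p`. -/
theorem exists_quadrature (L : ℝ[X] →ₗ[ℝ] ℝ) {p : ℝ[X]} (hp : p.Monic) {n : ℕ}
    (hn : p.natDegree ≤ n)
    (hpos : ∀ f : ℝ[X], f ≠ 0 → f.degree < p.degree → 0 < L (f * f))
    (horth : ∀ q : ℝ[X], q.degree < n → L (p * q) = 0) :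
    ∃ (s : Finset ℝ) (w : ℝ → ℝ), s.card = p.natDegree ∧ (∀ t ∈ s, 0 < w t) ∧
      ∀ f : ℝ[X], f.degree < (n + p.natDegree : ℕ) → L f = ∑ t ∈ s, w t * f.eval t := by
  classical
  have hle : p.degree ≤ (n : WithBot ℕ) := degree_le_natDegree.trans (by exact_mod_cast hn)
  have horth' : ∀ q : ℝ[X], q.degree < p.degree → L (p * q) = 0 :=
    fun q hq => horth q (hq.trans_le hle)
  have hnd := nodup_roots_of_orthogonal L hp hpos horth'
  have hcard : p.roots.toFinset.card = p.natDegree := by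
    rw [Multiset.toFinset_card_of_nodup hnd]
    exact splits_iff_card_roots.1 (splits_of_orthogonal L hp hpos horth')
  set s := p.roots.toFinset with hs
  have hroot : ∀ t ∈ s, p.eval t = 0 := fun t ht => by
    rw [hs, Multiset.mem_toFinset] at ht
    exact (mem_roots'.1 ht).2
  have hinj : Set.InjOn (id : ℝ → ℝ) s := Set.injOn_id _
  have hdeg : p.degree = (s.card : WithBot ℕ) := by
    rw [hcard, degree_eq_natDegree hp.ne_zero]
  have hmatch : ∀ f : ℝ[X], f.degree < (n + p.natDegree : ℕ) →
      L f = ∑ t ∈ s, L (Lagrange.basis s id t) * f.eval t := by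
    intro f hf
    have hq : (f /ₘ p).degree < (n : WithBot ℕ) := by
      by_cases h0 : f /ₘ p = 0
      · rw [h0, degree_zero]; exact WithBot.bot_lt_coe n
      · have hpf : p.degree ≤ f.degree := by
          by_contra! h
          exact h0 ((divByMonic_eq_zero_iff hp).2 h)
        have := degree_add_divByMonic hp hpf
        rw [← this, degree_eq_natDegree h0, degree_eq_natDegree hp.ne_zero] at hf
        rw [degree_eq_natDegree h0]
        norm_cast at hf ⊢
        omega
    have hrem := Lagrange.eq_interpolate (f := f %ₘ p) hinj
      (hdeg ▸ degree_modByMonic_lt f hp)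
    have heval : ∀ t ∈ s, (f %ₘ p).eval t = f.eval t := fun t ht => by
      conv_rhs => rw [← modByMonic_add_div f p]
      simp [hroot t ht]
    conv_lhs => rw [← modByMonic_add_div f p, map_add, horth _ hq, add_zero, hrem,
      Lagrange.interpolate_apply, map_sum]
    refine Finset.sum_congr rfl fun t ht => ?_
    rw [id, heval t ht, ← smul_eq_C_mul, map_smul, smul_eq_mul, mul_comm]
  refine ⟨s, fun t => L (Lagrange.basis s id t), hcard, fun t ht => ?_, hmatch⟩
  have hbd := Lagrange.degree_basis hinj ht
  have hspos : 0 < s.card := Finset.card_pos.2 ⟨t, ht⟩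
  have hb0 : Lagrange.basis s id t ≠ 0 := Lagrange.basis_ne_zero hinj ht
  have h1 := hpos (Lagrange.basis s id t) hb0
    (by rw [hbd, hdeg]; exact_mod_cast (by omega))
  rw [hmatch (Lagrange.basis s id t * Lagrange.basis s id t)
    (by rw [degree_mul, hbd]; norm_cast; omega), Finset.sum_eq_single t] at h1
  · have he : (Lagrange.basis s id t).eval t = 1 := Lagrange.eval_basis_self hinj ht
    simpa [he] using h1
  · intro u hu hut
    have he : (Lagrange.basis s id t).eval u = 0 := Lagrange.eval_basis_of_ne (v := id) hut.symm hu
    simp [he]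
  · exact fun h => absurd ht h

/-- If moreover some monic `g` of degree `n` is `L`-orthogonal to all polynomials of degree at most
`n`, then the quadrature is exact in degrees up to `2 * n`: `g` vanishes at the nodes, so `L` and
the quadrature both reduce modulo `g` to degrees less than `n`. -/
theorem exists_quadrature_of_flat (L : ℝ[X] →ₗ[ℝ] ℝ) {p g : ℝ[X]} (hp : p.Monic) {n : ℕ}
    (hn : p.natDegree ≤ n)
    (hpos : ∀ f : ℝ[X], f ≠ 0 → f.degree < p.degree → 0 < L (f * f))
    (horth : ∀ q : ℝ[X], q.degree < n → L (p * q) = 0)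
    (hg : g.Monic) (hgn : g.natDegree = n)
    (hgorth : ∀ q : ℝ[X], q.degree < (n + 1 : ℕ) → L (g * q) = 0) :
    ∃ (s : Finset ℝ) (w : ℝ → ℝ), s.card = p.natDegree ∧ (∀ t ∈ s, 0 < w t) ∧
      ∀ f : ℝ[X], f.degree < (2 * n + 1 : ℕ) → L f = ∑ t ∈ s, w t * f.eval t := by
  classical
  obtain ⟨s, w, hs, hw, hL⟩ := exists_quadrature L hp hn hpos horth
  have hinj : Set.InjOn (id : ℝ → ℝ) s := Set.injOn_id _
  have hgd : g.degree = (n : WithBot ℕ) := by rw [degree_eq_natDegree hg.ne_zero, hgn]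
  have hzero : ∀ t ∈ s, g.eval t = 0 := by
    intro t ht
    have hbd := Lagrange.degree_basis hinj ht
    have hspos : 0 < s.card := Finset.card_pos.2 ⟨t, ht⟩
    have h0 := hgorth (Lagrange.basis s id t) (by rw [hbd]; exact_mod_cast (by omega))
    rw [hL (g * Lagrange.basis s id t)
      (by rw [degree_mul, hbd, hgd]; norm_cast; omega), Finset.sum_eq_single t] at h0
    · have he : (Lagrange.basis s id t).eval t = 1 := Lagrange.eval_basis_self hinj ht
      simpa [he, (hw t ht).ne'] using h0
    · intro u hu hut
      have he : (Lagrange.basis s id t).eval u = 0 := Lagrange.eval_basis_of_ne (v := id) hut.symm hu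
      simp [he]
    · exact fun h => absurd ht h
  refine ⟨s, w, hs, hw, fun f hf => ?_⟩
  have hq : (f /ₘ g).degree < (n + 1 : ℕ) := by
    by_cases h0 : f /ₘ g = 0
    · rw [h0, degree_zero]; exact WithBot.bot_lt_coe _
    · have hpf : g.degree ≤ f.degree := by
        by_contra! h
        exact h0 ((divByMonic_eq_zero_iff hg).2 h)
      have := degree_add_divByMonic hg hpf
      rw [← this, degree_eq_natDegree h0, hgd] at hf
      rw [degree_eq_natDegree h0]
      norm_cast at hf ⊢
      omega
  conv_lhs => rw [← modByMonic_add_div f g, map_add, hgorth _ hq, add_zero]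
  rw [hL]
  · refine Finset.sum_congr rfl fun t ht => ?_
    conv_rhs => rw [← modByMonic_add_div f g]
    simp [hzero t ht]
  · refine (degree_modByMonic_lt f hg).trans_le ?_
    rw [hgd]
    exact_mod_cast (by omega)

/-! ### The moment functional and Hankel matrices -/

/-- The linear functional on `ℝ[X]` with moments `γ`, sending `X ^ n` to `γ n`. -/
noncomputable def momentFunctional (γ : ℕ → ℝ) : ℝ[X] →ₗ[ℝ] ℝ :=
  lsum fun n => γ n • LinearMap.id

@[simp]
lemma momentFunctional_X_pow (γ : ℕ → ℝ) (n : ℕ) : momentFunctional γ (X ^ n) = γ n := by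
  simp [momentFunctional, lsum_apply, ← monomial_one_right_eq_X_pow]

/-- Changing one moment `γ m` changes the functional by the coefficient of `X ^ m`. -/
lemma momentFunctional_update (γ : ℕ → ℝ) (m : ℕ) (x : ℝ) (p : ℝ[X]) :
    momentFunctional (Function.update γ m x) p
      = momentFunctional γ p + p.coeff m * (x - γ m) := by
  induction p using Polynomial.induction_on' with
  | add p q hp hq => rw [map_add, map_add, hp, hq, coeff_add]; ring
  | monomial n a =>
    rw [← C_mul_X_pow_eq_monomial, ← smul_eq_C_mul, map_smul, map_smul, momentFunctional_X_pow,
      momentFunctional_X_pow, coeff_smul, coeff_X_pow]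
    by_cases h : m = n
    · subst h; simp; ring
    · simp [h, Function.update_of_ne (Ne.symm h)]

lemma eq_sum_fin_of_degree_lt {q : ℝ[X]} {n : ℕ} (hq : q.degree < n) :
    q = ∑ i : Fin n, q.coeff i • X ^ (i : ℕ) := by
  ext m
  by_cases hm : m < n
  · simp [coeff_X_pow, Fin.sum_univ_eq_sum_range
      (fun i => if m = i then q.coeff i else 0) n, hm]
  · have h0 : q.coeff m = 0 := coeff_eq_zero_of_degree_lt
      (hq.trans_le (by exact_mod_cast not_lt.1 hm))
    rw [h0, finsetSum_coeff]
    refine (Finset.sum_eq_zero fun i _ => ?_).symm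
    rw [coeff_smul, coeff_X_pow, if_neg (by omega), smul_zero]

lemma degree_sum_smul_X_pow_lt {n : ℕ} (x : Fin n → ℝ) :
    (∑ i : Fin n, x i • (X : ℝ[X]) ^ (i : ℕ)).degree < n := by
  simp only [smul_eq_C_mul]
  exact Polynomial.degree_sum_fin_lt x

lemma map_mul_eq_zero_of_degree_lt (L : ℝ[X] →ₗ[ℝ] ℝ) {p q : ℝ[X]} {n : ℕ}
    (h : ∀ i < n, L (p * X ^ i) = 0) (hq : q.degree < n) : L (p * q) = 0 := by
  rw [eq_sum_fin_of_degree_lt hq, Finset.mul_sum, map_sum]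
  refine Finset.sum_eq_zero fun i _ => ?_
  rw [mul_smul_comm, map_smul, h i i.2, smul_zero]

/-- The matrix `(γ_{e i + e j})`: the principal submatrix of the infinite Hankel matrix of `γ` at
the rows and columns `e i`. -/
def momentMatrix {ι : Type*} (e : ι → ℕ) (γ : ℕ → ℝ) : Matrix ι ι ℝ :=
  Matrix.of fun i j => γ (e i + e j)

lemma hankel_eq_momentMatrix (n : ℕ) (γ : ℕ → ℝ) :
    hankel n γ = momentMatrix (fun i : Fin n => (i : ℕ)) γ := rfl

lemma borderedHankel_eq_momentMatrix (k : ℕ) (γ : ℕ → ℝ) :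
    borderedHankel k γ
      = momentMatrix (Sum.elim (fun i : Fin (k - 1) => (i : ℕ)) fun _ : Unit => k) γ := by
  ext i j
  rcases i with i | i <;> rcases j with j | j <;>
    simp [borderedHankel, momentMatrix, hankel, two_mul, add_comm]

lemma momentMatrix_transpose {ι : Type*} (e : ι → ℕ) (γ : ℕ → ℝ) :
    (momentMatrix e γ).transpose = momentMatrix e γ := by
  ext i j
  simp [momentMatrix, add_comm]

section Fintype

variable {ι : Type*} [Fintype ι] (e : ι → ℕ) (γ : ℕ → ℝ)

lemma momentMatrix_mulVec (x : ι → ℝ) (i : ι) :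
    (momentMatrix e γ).mulVec x i
      = momentFunctional γ ((∑ j, x j • X ^ e j) * X ^ e i) := by
  rw [Finset.sum_mul, map_sum]
  refine Finset.sum_congr rfl fun j _ => ?_
  rw [smul_mul_assoc, map_smul, ← pow_add, momentFunctional_X_pow, smul_eq_mul, mul_comm, add_comm]
  rfl

lemma dotProduct_momentMatrix_mulVec (x : ι → ℝ) :
    dotProduct x ((momentMatrix e γ).mulVec x)
      = momentFunctional γ ((∑ j, x j • X ^ e j) * ∑ j, x j • X ^ e j) := by
  conv_rhs => rw [Finset.mul_sum, map_sum]
  refine Finset.sum_congr rfl fun j _ => ?_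
  rw [mul_smul_comm, map_smul, momentMatrix_mulVec, smul_eq_mul]

lemma momentMatrix_posSemidef_iff : (momentMatrix e γ).PosSemidef ↔
    ∀ x : ι → ℝ, 0 ≤ momentFunctional γ ((∑ j, x j • X ^ e j) * ∑ j, x j • X ^ e j) := by
  simp only [← dotProduct_momentMatrix_mulVec]
  refine ⟨fun h x => by simpa using h.dotProduct_mulVec_nonneg x, fun h =>
    .of_dotProduct_mulVec_nonneg ?_ fun x => by simpa using h x⟩
  rw [Matrix.IsHermitian, Matrix.conjTranspose_eq_transpose_of_trivial, momentMatrix_transpose]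

end Fintype

lemma hankel_posDef_iff (n : ℕ) (γ : ℕ → ℝ) : (hankel n γ).PosDef ↔
    ∀ p : ℝ[X], p ≠ 0 → p.degree < n → 0 < momentFunctional γ (p * p) := by
  rw [hankel_eq_momentMatrix]
  constructor
  · intro h p hp hd
    have hx : (fun i : Fin n => p.coeff i) ≠ 0 := by
      intro h0
      apply hp
      rw [eq_sum_fin_of_degree_lt hd]
      exact Finset.sum_eq_zero fun i _ => by rw [show p.coeff i = 0 from congrFun h0 i, zero_smul]
    have := h.dotProduct_mulVec_pos hx
    rwa [star_trivial, dotProduct_momentMatrix_mulVec, ← eq_sum_fin_of_degree_lt hd] at this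
  · intro h
    refine .of_dotProduct_mulVec_pos ?_ fun x hx => ?_
    · rw [Matrix.IsHermitian, Matrix.conjTranspose_eq_transpose_of_trivial, momentMatrix_transpose]
    rw [star_trivial, dotProduct_momentMatrix_mulVec]
    refine h _ (fun h0 => hx ?_) (degree_sum_smul_X_pow_lt x)
    ext i
    have := congrArg (fun p => p.coeff i) h0
    simpa [coeff_X_pow, Fin.val_inj] using this

lemma exists_hankel_mulVec_eq {n : ℕ} {γ : ℕ → ℝ} (h : (hankel n γ).PosDef) (v : Fin n → ℝ) :
    ∃ c, (hankel n γ).mulVec c = v :=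
  (Matrix.mulVec_surjective_iff_isUnit.2 h.isUnit) v

/-! ### Ranks of symmetric matrices and of their principal submatrices -/

/-- If a submatrix has the rank of the whole matrix, the columns it meets span all columns. -/
lemma exists_mulVec_of_rank_submatrix_eq {m n m' n' : Type*} [Fintype m] [Fintype n] [Fintype m']
    [Fintype n'] (M : Matrix m n ℝ) (e : m' → m) (f : n' → n)
    (h : (M.submatrix e f).rank = M.rank) (x : n → ℝ) :
    ∃ c : n' → ℝ, (M.submatrix id f).mulVec c = M.mulVec x := by
  have h1 : (M.submatrix e f).rank ≤ (M.submatrix id f).rank :=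
    (M.submatrix id f).rank_submatrix_le e id
  have h2 : (M.submatrix id f).rank ≤ M.rank := M.rank_submatrix_le id f
  have hle : LinearMap.range (M.submatrix id f).mulVecLin ≤ LinearMap.range M.mulVecLin := by
    rw [Matrix.range_mulVecLin, Matrix.range_mulVecLin]
    apply Submodule.span_mono
    rintro _ ⟨j, rfl⟩
    exact ⟨f j, rfl⟩
  have heq := Submodule.eq_of_le_of_finrank_eq hle (le_antisymm h2 (h.ge.trans h1))
  have : M.mulVecLin x ∈ LinearMap.range (M.submatrix id f).mulVecLin := heq ▸ ⟨x, rfl⟩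
  exact this

/-- If some columns of a symmetric matrix span all of its columns, then the corresponding principal
submatrix has the same rank. -/
lemma rank_submatrix_eq_of_forall_exists_mulVec {n n' : Type*} [Fintype n] [Fintype n']
    {M : Matrix n n ℝ} (hM : M.transpose = M) (f : n' → n)
    (h : ∀ j, ∃ c : n' → ℝ, (M.submatrix id f).mulVec c = M.col j) :
    (M.submatrix f f).rank = M.rank := by
  refine le_antisymm (M.rank_submatrix_le f f) ?_
  choose c hc using h
  have h1 : M = M.submatrix id f * (Matrix.of c).transpose := by
    ext i j
    exact (congrFun (hc j) i).symm
  have h2 : M.submatrix f id = M.submatrix f f * (Matrix.of c).transpose := by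
    conv_lhs => rw [h1]
    rfl
  calc M.rank ≤ (M.submatrix id f).rank := by
        conv_lhs => rw [h1]
        exact Matrix.rank_mul_le_left _ _
    _ = (M.submatrix f id).rank := by
        rw [← Matrix.rank_transpose, Matrix.transpose_submatrix, hM]
    _ ≤ (M.submatrix f f).rank := by
        rw [h2]
        exact Matrix.rank_mul_le_left _ _

/-- Suppose the rows selected by `f` carry the exponents `0, …, n - 1`. The principal submatrix on
them has the rank of the whole moment matrix if and only if every `X ^ e j` agrees, when paired with
all the powers `X ^ e i`, with a polynomial of degree less than `n`. -/
lemma rank_hankel_eq_rank_momentMatrix_iff {ι : Type*} [Fintype ι] (e : ι → ℕ) (γ : ℕ → ℝ) {n : ℕ}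
    (f : Fin n → ι) (hf : ∀ i, e (f i) = i) :
    (hankel n γ).rank = (momentMatrix e γ).rank ↔ ∀ j, ∃ c : ℝ[X], c.degree < n ∧
      ∀ i, momentFunctional γ (c * X ^ e i) = γ (e j + e i) := by
  classical
  have hsub : (momentMatrix e γ).submatrix f f = hankel n γ := by
    ext i j
    simp [momentMatrix, hankel, hf]
  have hmul : ∀ (x : Fin n → ℝ) (i : ι), ((momentMatrix e γ).submatrix id f).mulVec x i
      = momentFunctional γ ((∑ l : Fin n, x l • X ^ (l : ℕ)) * X ^ e i) := by
    intro x i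
    rw [Finset.sum_mul, map_sum, Matrix.mulVec, dotProduct]
    refine Finset.sum_congr rfl fun l _ => ?_
    rw [smul_mul_assoc, map_smul, ← pow_add, momentFunctional_X_pow, smul_eq_mul, mul_comm,
      add_comm, ← hf l]
    rfl
  rw [← hsub]
  constructor
  · intro h j
    obtain ⟨x, hx⟩ := exists_mulVec_of_rank_submatrix_eq _ f f h (Pi.single j 1)
    refine ⟨∑ l, x l • X ^ (l : ℕ), degree_sum_smul_X_pow_lt x, fun i => ?_⟩
    rw [← hmul, hx, Matrix.mulVec_single_one, add_comm]
    rfl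
  · intro h
    refine rank_submatrix_eq_of_forall_exists_mulVec (momentMatrix_transpose e γ) f fun j => ?_
    obtain ⟨c, hc, hci⟩ := h j
    refine ⟨fun i => c.coeff i, ?_⟩
    ext i
    rw [hmul, ← eq_sum_fin_of_degree_lt hc, hci, add_comm]
    rfl

/-! ### The rank of a sequence and orthogonal polynomials -/

/-- The Cauchy-Schwarz inequality in the degenerate case: a null vector of a positive semidefinite
form is orthogonal to everything. -/
lemma map_mul_eq_zero_of_map_mul_self_eq_zero (L : ℝ[X] →ₗ[ℝ] ℝ) {n : WithBot ℕ}
    (hpsd : ∀ p : ℝ[X], p.degree < n → 0 ≤ L (p * p)) {f q : ℝ[X]} (hf : f.degree < n)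
    (h0 : L (f * f) = 0) (hq : q.degree < n) : L (f * q) = 0 := by
  by_contra hb
  -- At this `t` the polynomial `t ↦ L ((q + t f)²) = L (q²) + 2 t L (f q)` takes the value `-1`.
  set t : ℝ := -(L (q * q) + 1) / (2 * L (f * q)) with ht
  have h1 := hpsd (q + t • f)
    ((degree_add_le _ _).trans_lt (max_lt hq ((degree_smul_le t f).trans_lt hf)))
  have h2 : (q + t • f) * (q + t • f) = q * q + (2 * t) • (f * q) + (t ^ 2) • (f * f) := by
    simp only [smul_eq_C_mul, map_mul, map_pow, map_ofNat]
    ring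
  rw [h2, map_add, map_add, map_smul, map_smul, h0, smul_zero, add_zero, smul_eq_mul] at h1
  have h3 : 2 * t * L (f * q) = -(L (q * q) + 1) := by
    rw [ht]; field_simp
  linarith

/-- Column `i` of the Hankel matrix depends on the preceding ones if and only if some monic
polynomial of degree `i` is orthogonal to all polynomials of degree less than the size. -/
lemma hankel_col_mem_span_iff {n : ℕ} {γ : ℕ → ℝ} {i : ℕ} (hi : i < n) :
    (hankel n γ).col ⟨i, hi⟩ ∈
        Submodule.span ℝ ((hankel n γ).col '' {j : Fin n | (j : ℕ) < i}) ↔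
      ∃ p : ℝ[X], p.Monic ∧ p.natDegree = i ∧
        ∀ q : ℝ[X], q.degree < n → momentFunctional γ (p * q) = 0 := by
  constructor
  · rw [Finsupp.mem_span_image_iff_linearCombination]
    rintro ⟨l, hl, hsum⟩
    have hd : (∑ j : Fin n, l j • (X : ℝ[X]) ^ (j : ℕ)).degree < (i : WithBot ℕ) := by
      refine (degree_lt_iff_coeff_zero _ _).2 fun m hm => ?_
      rw [finsetSum_coeff]
      refine Finset.sum_eq_zero fun j _ => ?_
      rw [coeff_smul, coeff_X_pow]
      split_ifs with h
      · have : l j = 0 := by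
          by_contra h0
          have : (j : ℕ) < i := hl (Finsupp.mem_support_iff.2 h0)
          omega
        rw [this, zero_smul]
      · rw [smul_zero]
    refine ⟨X ^ i - ∑ j : Fin n, l j • X ^ (j : ℕ), monic_X_pow_sub hd, ?_, fun q hq => ?_⟩
    · refine natDegree_eq_of_degree_eq_some ?_
      rw [degree_sub_eq_left_of_degree_lt] <;> rw [degree_X_pow]
      exact hd
    · refine map_mul_eq_zero_of_degree_lt _ (fun m hm => ?_) hq
      have h := congrFun hsum ⟨m, hm⟩
      rw [sub_mul, map_sub, ← pow_add, momentFunctional_X_pow, Finset.sum_mul, map_sum, sub_eq_zero]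
      rw [Finsupp.linearCombination_apply, Finsupp.sum_fintype _ _ (by simp), Finset.sum_apply] at h
      refine ((congrArg γ (add_comm i m)).trans h.symm).trans (Finset.sum_congr rfl fun j _ => ?_)
      rw [smul_mul_assoc, map_smul, ← pow_add, momentFunctional_X_pow, add_comm]
      rfl
  · rintro ⟨p, hp, hpi, horth⟩
    have hd : (X ^ i - p).degree < (i : WithBot ℕ) := by
      have hpd : p.degree = (i : WithBot ℕ) := by rw [degree_eq_natDegree hp.ne_zero, hpi]
      have := degree_sub_lt_left (p := X ^ i) (q := p) (by rw [degree_X_pow, hpd])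
        (monic_X_pow i).ne_zero (by rw [(monic_X_pow i).leadingCoeff, hp.leadingCoeff])
      rwa [degree_X_pow] at this
    have hcol : (hankel n γ).col ⟨i, hi⟩
        = ∑ j : Fin i, (X ^ i - p).coeff j • (hankel n γ).col ⟨j, j.2.trans hi⟩ := by
      ext m
      have h := horth (X ^ (m : ℕ)) (by rw [degree_X_pow]; exact_mod_cast m.2)
      have h1 : momentFunctional γ ((X ^ i - p) * X ^ (m : ℕ)) = γ (i + m) := by
        rw [sub_mul, map_sub, h, sub_zero, ← pow_add, momentFunctional_X_pow]
      rw [eq_sum_fin_of_degree_lt hd, Finset.sum_mul, map_sum] at h1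
      rw [Finset.sum_apply]
      refine ((congrArg γ (add_comm _ _)).trans h1.symm).trans (Finset.sum_congr rfl fun j _ => ?_)
      rw [smul_mul_assoc, map_smul, ← pow_add, momentFunctional_X_pow, add_comm]
      rfl
    rw [hcol]
    exact Submodule.sum_mem _ fun j _ => Submodule.smul_mem _ _
      (Submodule.subset_span ⟨_, j.2, rfl⟩)

lemma exists_monic_of_orthogonal (L : ℝ[X] →ₗ[ℝ] ℝ) {f : ℝ[X]} (hf : f ≠ 0) {n : WithBot ℕ}
    (h : ∀ q : ℝ[X], q.degree < n → L (f * q) = 0) :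
    ∃ p : ℝ[X], p.Monic ∧ p.natDegree = f.natDegree ∧
      ∀ q : ℝ[X], q.degree < n → L (p * q) = 0 := by
  refine ⟨f * C f.leadingCoeff⁻¹, monic_mul_leadingCoeff_inv hf,
    natDegree_mul_leadingCoeff_inv f hf, fun q hq => ?_⟩
  rw [mul_right_comm, mul_comm, ← smul_eq_C_mul, map_smul, h q hq, smul_zero]

/-- For a positive semidefinite Hankel matrix the rank of the sequence is the least degree of a
nonzero polynomial in the radical: below it the form is definite. If the matrix is nonsingular there
is no such polynomial of degree less than `n`, and the rank is `n`. -/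
theorem seqRank_spec {n : ℕ} {γ : ℕ → ℝ}
    (hpsd : ∀ p : ℝ[X], p.degree < n → 0 ≤ momentFunctional γ (p * p)) :
    seqRank n γ ≤ n ∧
      (∀ f : ℝ[X], f ≠ 0 → f.degree < seqRank n γ → 0 < momentFunctional γ (f * f)) ∧
      (seqRank n γ < n → ∃ p : ℝ[X], p.Monic ∧ p.natDegree = seqRank n γ ∧
        ∀ q : ℝ[X], q.degree < n → momentFunctional γ (p * q) = 0) := by
  classical
  by_cases hu : IsUnit (hankel n γ)
  · have hr : seqRank n γ = n := by rw [seqRank, if_pos hu]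
    rw [hr]
    refine ⟨le_rfl, fun f hf hd => (hpsd f hd).lt_of_ne' fun h0 => hf ?_,
      fun h => absurd h (lt_irrefl _)⟩
    have hker : (hankel n γ).mulVec (fun i : Fin n => f.coeff i) = 0 := by
      ext i
      rw [hankel_eq_momentMatrix, momentMatrix_mulVec, ← eq_sum_fin_of_degree_lt hd]
      exact map_mul_eq_zero_of_map_mul_self_eq_zero _ hpsd hd h0
        (by rw [degree_X_pow]; exact_mod_cast i.2)
    have hinj := Matrix.mulVec_injective_iff_isUnit.2 hu
    have hz := hinj (hker.trans (Matrix.mulVec_zero _).symm)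
    rw [eq_sum_fin_of_degree_lt hd]
    exact Finset.sum_eq_zero fun i _ => by rw [show f.coeff i = 0 from congrFun hz i, zero_smul]
  · set S := {i : ℕ | ∃ hi : i < n, (hankel n γ).col ⟨i, hi⟩ ∈
      Submodule.span ℝ ((hankel n γ).col '' {j : Fin n | (j : ℕ) < i})} with hS
    have hr : seqRank n γ = sInf S := by rw [seqRank, if_neg hu]
    have hmem : ∀ f : ℝ[X], f ≠ 0 → f.degree < n →
        (∀ q : ℝ[X], q.degree < n → momentFunctional γ (f * q) = 0) → f.natDegree ∈ S := by
      intro f hf hd h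
      have hi : f.natDegree < n := (natDegree_lt_iff_degree_lt hf).2 hd
      exact ⟨hi, (hankel_col_mem_span_iff hi).2 (exists_monic_of_orthogonal _ hf h)⟩
    have hne : S.Nonempty := by
      rw [Matrix.isUnit_iff_isUnit_det, isUnit_iff_ne_zero, not_not,
        ← Matrix.exists_mulVec_eq_zero_iff] at hu
      obtain ⟨v, hv, hker⟩ := hu
      refine ⟨_, hmem (∑ j : Fin n, v j • X ^ (j : ℕ)) (fun h0 => hv ?_)
        (degree_sum_smul_X_pow_lt v) fun q hq => map_mul_eq_zero_of_degree_lt _ (fun i hi => ?_) hq⟩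
      · ext i
        have := congrArg (fun p => p.coeff i) h0
        simpa [coeff_X_pow, Fin.val_inj] using this
      · have := congrFun hker ⟨i, hi⟩
        rwa [hankel_eq_momentMatrix, momentMatrix_mulVec] at this
    obtain ⟨hlt, hspan⟩ := Nat.sInf_mem hne
    rw [hr]
    refine ⟨hlt.le, fun f hf hd => ?_, fun _ => (hankel_col_mem_span_iff hlt).1 hspan⟩
    have hdn : f.degree < n := hd.trans (by exact_mod_cast hlt)
    refine (hpsd f hdn).lt_of_ne' fun h0 => ?_
    have h1 := Nat.sInf_le (hmem f hf hdn fun q hq =>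
      map_mul_eq_zero_of_map_mul_self_eq_zero _ hpsd hdn h0 hq)
    have h2 := (natDegree_lt_iff_degree_lt hf).2 hd
    omega

/-! ### Atomic representing measures -/

lemma isRepresentingMeasure_sum_dirac {d : ℕ} {γ : ℕ → ℝ} {s : Finset ℝ} {w : ℝ → ℝ}
    (hw : ∀ t ∈ s, 0 < w t) (h : ∀ i ≤ d, γ i = ∑ t ∈ s, w t * t ^ i) :
    IsRepresentingMeasure d γ (∑ t ∈ s, ENNReal.ofReal (w t) • Measure.dirac t) := by
  intro i hi
  have hint : ∀ t ∈ s, Integrable (fun u : ℝ => u ^ i) (ENNReal.ofReal (w t) • Measure.dirac t) :=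
    fun t _ => (integrable_dirac (by simp)).smul_measure ENNReal.ofReal_ne_top
  refine ⟨integrable_finsetSum_measure.2 hint, ?_⟩
  rw [integral_finsetSum_measure hint, h i hi]
  refine Finset.sum_congr rfl fun t ht => ?_
  rw [integral_smul_measure, integral_dirac, ENNReal.toReal_ofReal (hw t ht).le, smul_eq_mul]

/-- A **flat extension** has an atomic representing measure: the form given by `γ` is positive
semidefinite in degrees less than `n`, and a monic `g` of degree `n` lies in the radical of the form
in degrees at most `n`. -/
theorem exists_atomic_of_flat {n : ℕ} {γ : ℕ → ℝ}
    (hpsd : ∀ p : ℝ[X], p.degree < n → 0 ≤ momentFunctional γ (p * p)) {g : ℝ[X]}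
    (hg : g.Monic) (hgn : g.natDegree = n)
    (hgorth : ∀ q : ℝ[X], q.degree < (n + 1 : ℕ) → momentFunctional γ (g * q) = 0) :
    ∃ μ : Measure ℝ, IsRepresentingMeasure (2 * n) γ μ ∧ IsAtomicMeasure (seqRank n γ) μ := by
  obtain ⟨hle, hpos, hex⟩ := seqRank_spec hpsd
  obtain ⟨p, hp, hpr, horth⟩ : ∃ p : ℝ[X], p.Monic ∧ p.natDegree = seqRank n γ ∧
      ∀ q : ℝ[X], q.degree < n → momentFunctional γ (p * q) = 0 := by
    rcases hle.lt_or_eq with h | h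
    · exact hex h
    · exact ⟨g, hg, hgn.trans h.symm, fun q hq =>
        hgorth q (hq.trans (by exact_mod_cast Nat.lt_succ_self n))⟩
  obtain ⟨s, w, hs, hw, hL⟩ := exists_quadrature_of_flat (momentFunctional γ) hp (hpr ▸ hle)
    (fun f hf hd => hpos f hf (by rwa [degree_eq_natDegree hp.ne_zero, hpr] at hd)) horth hg hgn
    hgorth
  refine ⟨_, isRepresentingMeasure_sum_dirac hw fun i hi => ?_, s, w, hs.trans hpr, hw, rfl⟩
  have := hL (X ^ i) (by rw [degree_X_pow]; exact_mod_cast (by omega))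
  simpa using this

/-! ### Filling the gap -/

lemma degree_mul_self_lt {p : ℝ[X]} {k : ℕ} (hp : p.degree < k) :
    (p * p).degree < (2 * k - 1 : ℕ) := by
  by_cases hp0 : p = 0
  · rw [hp0, zero_mul, degree_zero]; exact WithBot.bot_lt_coe _
  rw [degree_eq_natDegree hp0] at hp
  rw [degree_mul, degree_eq_natDegree hp0]
  norm_cast at hp ⊢
  omega

lemma hankel_fillGap {k : ℕ} (hk : 1 ≤ k) (β : ℕ → ℝ) (x : ℝ) :
    hankel k (fillGap k β x) = hankel k β := by
  ext i j
  simp only [hankel, Matrix.of_apply, fillGap]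
  rw [Function.update_of_ne]
  omega

lemma seqRank_fillGap {k : ℕ} (hk : 1 ≤ k) (β : ℕ → ℝ) (x : ℝ) :
    seqRank k (fillGap k β x) = seqRank k β := by
  unfold seqRank
  rw [hankel_fillGap hk]

lemma momentFunctional_fillGap_of_degree_lt {k : ℕ} (β : ℕ → ℝ) (x : ℝ) {p : ℝ[X]}
    (hp : p.degree < (2 * k - 1 : ℕ)) :
    momentFunctional (fillGap k β x) p = momentFunctional β p := by
  rw [fillGap, momentFunctional_update, coeff_eq_zero_of_degree_lt hp, zero_mul, add_zero]

/-- Partial positive semidefiniteness gives positivity on the squares that do not involve the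
unspecified moment: only the rows and columns of nonzero coefficients of `p` matter. -/
lemma PartiallyPosSemidef.momentFunctional_mul_self_nonneg {k : ℕ} {β : ℕ → ℝ}
    (h : PartiallyPosSemidef (hankel (k + 1) (withGap k β))) {p : ℝ[X]}
    (hp : p.degree < (k + 1 : ℕ)) (h0 : p.coeff (k - 1) = 0 ∨ p.coeff k = 0) :
    0 ≤ momentFunctional β (p * p) := by
  classical
  set Q : Finset (Fin (k + 1)) := Finset.univ.filter fun i => p.coeff i ≠ 0 with hQ
  have hmem : ∀ i : Q, p.coeff (i : Fin (k + 1)) ≠ 0 := fun i =>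
    (Finset.mem_filter.1 i.2).2
  have hB := h.posSemidef Q (momentMatrix (fun i : Q => ((i : Fin (k + 1)) : ℕ)) β) fun i j => by
    have hi := (i : Fin (k + 1)).2
    have hj := (j : Fin (k + 1)).2
    simp only [hankel, Matrix.of_apply, withGap, momentMatrix]
    rw [Function.update_of_ne]
    intro hij
    have : ((i : Fin (k + 1)) : ℕ) = k - 1 ∧ ((j : Fin (k + 1)) : ℕ) = k ∨
      ((i : Fin (k + 1)) : ℕ) = k ∧ ((j : Fin (k + 1)) : ℕ) = k - 1 := by omega
    have h1 := hmem i
    have h2 := hmem j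
    rcases this with ⟨ha, hb⟩ | ⟨ha, hb⟩ <;> rw [ha] at h1 <;> rw [hb] at h2 <;> tauto
  have hsum : p = ∑ i : Q, p.coeff (i : Fin (k + 1)) • X ^ ((i : Fin (k + 1)) : ℕ) := by
    conv_lhs => rw [eq_sum_fin_of_degree_lt hp]
    rw [Finset.sum_coe_sort Q fun i : Fin (k + 1) => p.coeff i • (X : ℝ[X]) ^ (i : ℕ), hQ,
      Finset.sum_filter]
    refine Finset.sum_congr rfl fun i _ => ?_
    split_ifs with hi
    · rfl
    · rw [not_not.1 hi, zero_smul]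
  have := (momentMatrix_posSemidef_iff _ _).1 hB fun i => p.coeff (i : Fin (k + 1))
  rwa [← hsum] at this

/-- The common form of both alternatives of the criterion: modulo polynomials of degree less than
`k - 1`, the powers `X ^ (k - 1)` and `X ^ k` can be made orthogonal to those polynomials, and the
latter becomes a null vector if the former does. -/
theorem exists_flat_fillGap {k : ℕ} (hk : 1 ≤ k) {β : ℕ → ℝ}
    (hβ : PartiallyPosSemidef (hankel (k + 1) (withGap k β))) {c d : ℝ[X]}
    (hc : c.degree < (k - 1 : ℕ)) (hd : d.degree < (k - 1 : ℕ))
    (hdorth : ∀ q : ℝ[X], q.degree < (k - 1 : ℕ) →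
      momentFunctional β ((X ^ (k - 1) - d) * q) = 0)
    (hcorth : ∀ q : ℝ[X], q.degree < (k - 1 : ℕ) → momentFunctional β ((X ^ k - c) * q) = 0)
    (h0 : momentFunctional β ((X ^ (k - 1) - d) * (X ^ (k - 1) - d)) = 0 →
      momentFunctional β ((X ^ k - c) * (X ^ k - c)) = 0) :
    ∃ (x : ℝ) (g : ℝ[X]), g.Monic ∧ g.natDegree = k ∧ ∀ q : ℝ[X], q.degree < (k + 1 : ℕ) →
      momentFunctional (fillGap k β x) (g * q) = 0 := by
  obtain ⟨m, rfl⟩ : ∃ m, k = m + 1 := ⟨k - 1, by omega⟩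
  simp only [Nat.add_sub_cancel] at hc hd hdorth hcorth h0 ⊢
  set h := X ^ m - d with hh
  set u := X ^ (m + 1) - c with hu
  have hmm : (m : WithBot ℕ) < ((m + 1 : ℕ) : WithBot ℕ) := by exact_mod_cast Nat.lt_succ_self m
  have hhd : h.degree = (m : WithBot ℕ) := by
    rw [hh, degree_sub_eq_left_of_degree_lt] <;> rw [degree_X_pow]
    exact hd
  have hum : u.Monic := monic_X_pow_sub (hc.trans hmm)
  have hud : u.degree = ((m + 1 : ℕ) : WithBot ℕ) := by
    rw [hu, degree_sub_eq_left_of_degree_lt] <;> rw [degree_X_pow]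
    exact hc.trans hmm
  have hdm : d.coeff m = 0 := coeff_eq_zero_of_degree_lt hd
  have hcm : c.coeff m = 0 := coeff_eq_zero_of_degree_lt hc
  have hcm1 : c.coeff (m + 1) = 0 := coeff_eq_zero_of_degree_lt (hc.trans hmm)
  have hum0 : u.coeff m = 0 := by rw [hu, coeff_sub, hcm, coeff_X_pow]; simp
  set η := momentFunctional β (h * h) with hη
  set δ := momentFunctional β (u * u) with hδ
  have hη0 : 0 ≤ η := hβ.momentFunctional_mul_self_nonneg (hhd ▸ hmm.trans
    (by exact_mod_cast Nat.lt_succ_self _)) (Or.inr (coeff_eq_zero_of_degree_lt (hhd ▸ hmm)))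
  have hδ0 : 0 ≤ δ := hβ.momentFunctional_mul_self_nonneg (hud ▸
    (by exact_mod_cast Nat.lt_succ_self _)) (Or.inl (by simpa using hum0))
  -- The new moment enters `L (u * h)` with coefficient `1`; it is chosen such that
  -- `L (u * h) ^ 2 = L (u * u) * L (h * h)`.
  set x := β (2 * (m + 1) - 1) - momentFunctional β (u * h) + √(δ * η) with hx
  set L := momentFunctional (fillGap (m + 1) β x) with hL
  have hlow : ∀ p : ℝ[X], p.degree < ((2 * m + 1 : ℕ) : WithBot ℕ) →
      L p = momentFunctional β p := fun p hp => momentFunctional_fillGap_of_degree_lt β x hp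
  have hdeg : ∀ {a b : ℝ[X]} {i j : ℕ}, a.degree = (i : WithBot ℕ) → b.degree < (j : WithBot ℕ) →
      i + j ≤ 2 * m + 1 → (a * b).degree < ((2 * m + 1 : ℕ) : WithBot ℕ) := by
    intro a b i j ha hb hij
    rw [degree_mul, ha]
    calc (i : WithBot ℕ) + b.degree < i + j :=
          WithBot.add_lt_add_left (WithBot.coe_ne_bot) hb
      _ ≤ _ := by exact_mod_cast hij
  have hLhq : ∀ q : ℝ[X], q.degree < (m : WithBot ℕ) → L (h * q) = 0 := fun q hq => by
    rw [hlow _ (hdeg hhd hq (by omega)), hdorth q hq]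
  have hLuq : ∀ q : ℝ[X], q.degree < (m : WithBot ℕ) → L (u * q) = 0 := fun q hq => by
    rw [hlow _ (hdeg hud hq (by omega)), hcorth q hq]
  have hLhh : L (h * h) = η := hlow _ (hdeg hhd (hhd ▸ hmm) (by omega))
  have hLuh : L (u * h) = √(δ * η) := by
    have hco : (u * h).coeff (2 * (m + 1) - 1) = 1 := by
      have hhm : h.Monic := monic_X_pow_sub hd
      have hnd : (u * h).natDegree = 2 * (m + 1) - 1 := by
        rw [hum.natDegree_mul hhm, natDegree_eq_of_degree_eq_some hud,
          natDegree_eq_of_degree_eq_some hhd]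
        omega
      rw [← hnd]
      exact hum.mul hhm
    rw [hL, fillGap, momentFunctional_update, hco, hx]
    ring
  have hLuu : L (u * u) = δ := by
    have hco : (u * u).coeff (2 * (m + 1) - 1) = 0 := by
      have h1 : u * u = X ^ (2 * m + 2) - (2 : ℝ) • (c * X ^ (m + 1)) + c * c := by
        rw [hu, smul_eq_C_mul, map_ofNat]; ring
      rw [h1, coeff_add, coeff_sub, coeff_X_pow, coeff_smul, coeff_mul_X_pow']
      have h2 : (c * c).coeff (2 * (m + 1) - 1) = 0 := by
        by_cases hc0 : c = 0
        · simp [hc0]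
        refine coeff_eq_zero_of_degree_lt ?_
        rw [degree_eq_natDegree hc0] at hc
        rw [degree_mul, degree_eq_natDegree hc0]
        norm_cast at hc ⊢
        omega
      rw [h2, if_neg (by omega), if_pos (by omega),
        show 2 * (m + 1) - 1 - (m + 1) = m by omega, hcm]
      simp
    rw [hL, fillGap, momentFunctional_update, hco, zero_mul, add_zero]
  -- If `η = 0`, then `δ = 0` as well, and the value `s = 0` of the quotient is the right one.
  set s := √(δ * η) / η with hs
  have hsη : √(δ * η) = s * η := by
    by_cases hz : η = 0
    · simp [hz]
    · rw [hs, div_mul_cancel₀ _ hz]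
  have hsδ : δ = s * √(δ * η) := by
    by_cases hz : η = 0
    · rw [h0 hz]; simp
    · rw [hs, div_mul_eq_mul_div, Real.mul_self_sqrt (mul_nonneg hδ0 hη0),
        mul_div_cancel_right₀ _ hz]
  have hshd : (s • h).degree < u.degree :=
    (degree_smul_le s h).trans_lt (by rw [hhd, hud]; exact hmm)
  refine ⟨x, u - s • h, hum.sub_of_left hshd, ?_, fun q hq => ?_⟩
  · refine natDegree_eq_of_degree_eq_some ?_
    rw [degree_sub_eq_left_of_degree_lt hshd, hud]
  -- Reduce `q` to degree less than `m` by subtracting multiples of `u` and `h`.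
  set a := q.coeff (m + 1) with ha
  set b := q.coeff m with hb
  have hr : (q - a • u - b • h).degree < (m : WithBot ℕ) := by
    rw [degree_lt_iff_coeff_zero] at hq ⊢
    intro i hi
    have hdi : d.coeff i = 0 := coeff_eq_zero_of_degree_lt (hd.trans_le (by exact_mod_cast hi))
    have hci : c.coeff i = 0 := coeff_eq_zero_of_degree_lt (hc.trans_le (by exact_mod_cast hi))
    simp only [coeff_sub, coeff_smul, hu, hh, hdi, hci, coeff_X_pow, smul_eq_mul]
    rcases eq_or_lt_of_le hi with h1 | h1
    · subst h1; simp [hb]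
    · rcases eq_or_lt_of_le (Nat.succ_le_of_lt h1) with h2 | h2
      · subst h2; simp [ha]
      · rw [hq i h2, if_neg (by omega), if_neg (by omega)]; simp
  have hqe : (u - s • h) * q = u * (q - a • u - b • h) - s • (h * (q - a • u - b • h))
      + a • (u * u - s • (u * h)) + b • (u * h - s • (h * h)) := by
    simp only [smul_eq_C_mul]; ring
  change L ((u - s • h) * q) = 0
  rw [hqe]
  simp only [map_add, map_sub, map_smul, hLuq _ hr, hLhq _ hr, hLuu, hLuh, hLhh, smul_eq_mul]
  rw [← hsδ, ← hsη]
  ring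

/-- Sufficiency of the criterion. In the positive definite case `c` and `d` come from inverting the
Hankel matrix of size `k - 1`, in the other case from the equality of the ranks. -/
theorem exists_atomic_of_criterion {k : ℕ} (hk : 1 ≤ k) {β : ℕ → ℝ}
    (hβ : PartiallyPosSemidef (hankel (k + 1) (withGap k β)))
    (h : (hankel k β).PosDef ∨ ((hankel (k - 1) β).rank = (hankel k β).rank ∧
      (hankel k β).rank = (borderedHankel k β).rank)) :
    ∃ (x : ℝ) (μ : Measure ℝ),
      IsRepresentingMeasure (2 * k) (fillGap k β x) μ ∧ IsAtomicMeasure (seqRank k β) μ := by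
  have hpsd : ∀ p : ℝ[X], p.degree < k → 0 ≤ momentFunctional β (p * p) := fun p hp =>
    hβ.momentFunctional_mul_self_nonneg (hp.trans (by exact_mod_cast Nat.lt_succ_self k))
      (Or.inr (coeff_eq_zero_of_degree_lt hp))
  obtain ⟨x, g, hg, hgn, horth⟩ : ∃ (x : ℝ) (g : ℝ[X]), g.Monic ∧ g.natDegree = k ∧
      ∀ q : ℝ[X], q.degree < (k + 1 : ℕ) → momentFunctional (fillGap k β x) (g * q) = 0 := by
    rcases h with h | ⟨h1, h2⟩
    · have hpos := (hankel_posDef_iff k β).1 h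
      have hpd : (hankel (k - 1) β).PosDef := (hankel_posDef_iff _ _).2 fun p hp hd =>
        hpos p hp (hd.trans_le (by exact_mod_cast Nat.sub_le k 1))
      have hex : ∀ n : ℕ, ∃ c : ℝ[X], c.degree < (k - 1 : ℕ) ∧ ∀ q : ℝ[X], q.degree < (k - 1 : ℕ) →
          momentFunctional β ((X ^ n - c) * q) = 0 := by
        intro n
        obtain ⟨c, hc⟩ := exists_hankel_mulVec_eq hpd fun i => β (n + i)
        refine ⟨∑ j, c j • X ^ (j : ℕ), degree_sum_smul_X_pow_lt c, fun q hq =>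
          map_mul_eq_zero_of_degree_lt _ (fun i hi => ?_) hq⟩
        have := congrFun hc ⟨i, hi⟩
        rw [hankel_eq_momentMatrix, momentMatrix_mulVec] at this
        rw [sub_mul, map_sub, this, ← pow_add, momentFunctional_X_pow, sub_self]
      obtain ⟨d, hd, hdorth⟩ := hex (k - 1)
      obtain ⟨c, hc, hcorth⟩ := hex k
      refine exists_flat_fillGap hk hβ hc hd hdorth hcorth fun h0 => absurd h0 (hpos _ ?_ ?_).ne'
      · exact (monic_X_pow_sub hd).ne_zero
      · rw [degree_sub_eq_left_of_degree_lt] <;> rw [degree_X_pow]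
        · exact_mod_cast (by omega)
        · exact hd
    · -- Equal ranks express the last columns through the first `k - 1` ones.
      obtain ⟨d, hd, hdorth⟩ : ∃ d : ℝ[X], d.degree < (k - 1 : ℕ) ∧
          ∀ i : Fin k, momentFunctional β (d * X ^ (i : ℕ)) = β (k - 1 + i) :=
        (rank_hankel_eq_rank_momentMatrix_iff (fun i : Fin k => (i : ℕ)) β
          (Fin.castLE (Nat.sub_le k 1)) fun _ => rfl).1 h1 ⟨k - 1, by omega⟩
      rw [borderedHankel_eq_momentMatrix] at h2
      obtain ⟨c, hc, hcorth⟩ :=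
        (rank_hankel_eq_rank_momentMatrix_iff _ β Sum.inl fun _ => rfl).1 (h1.trans h2) (Sum.inr ())
      have hsub : ∀ {c : ℝ[X]} {n i : ℕ}, momentFunctional β (c * X ^ i) = β (n + i) →
          momentFunctional β ((X ^ n - c) * X ^ i) = 0 := fun h => by
        rw [sub_mul, map_sub, h, ← pow_add, momentFunctional_X_pow, sub_self]
      have hcq : ∀ q : ℝ[X], q.degree < (k - 1 : ℕ) →
          momentFunctional β ((X ^ k - c) * q) = 0 := fun q hq =>
        map_mul_eq_zero_of_degree_lt _ (fun i hi => hsub (hcorth (Sum.inl ⟨i, hi⟩))) hq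
      refine exists_flat_fillGap hk hβ hc hd (fun q hq =>
        map_mul_eq_zero_of_degree_lt _ (fun i hi => hsub (hdorth ⟨i, by omega⟩)) hq) hcq
        fun _ => ?_
      rw [mul_sub, map_sub, hcq c hc, sub_zero]
      exact hsub (hcorth (Sum.inr ()))
  have hpsd' : ∀ p : ℝ[X], p.degree < k → 0 ≤ momentFunctional (fillGap k β x) (p * p) := by
    intro p hp
    rw [momentFunctional_fillGap_of_degree_lt]
    · exact hpsd p hp
    · exact degree_mul_self_lt hp
  obtain ⟨μ, hμ, hat⟩ := exists_atomic_of_flat hpsd' hg hgn horth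
  exact ⟨x, μ, hμ, seqRank_fillGap hk β x ▸ hat⟩

/-! ### Necessity of the criterion -/

lemma IsRepresentingMeasure.integrable_integral {d : ℕ} {γ : ℕ → ℝ} {μ : Measure ℝ}
    (h : IsRepresentingMeasure d γ μ) {p : ℝ[X]} (hp : p.degree < (d + 1 : ℕ)) :
    Integrable (fun t => p.eval t) μ ∧ ∫ t, p.eval t ∂μ = momentFunctional γ p := by
  have he : (fun t => p.eval t) = fun t => ∑ i : Fin (d + 1), p.coeff i * t ^ (i : ℕ) := by
    ext t
    conv_lhs => rw [eq_sum_fin_of_degree_lt hp]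
    simp [eval_finsetSum]
  have hi : ∀ i : Fin (d + 1), Integrable (fun t : ℝ => p.coeff i * t ^ (i : ℕ)) μ :=
    fun i => (h i (Nat.lt_succ_iff.1 i.2)).1.const_mul _
  rw [he]
  refine ⟨integrable_finsetSum _ fun i _ => hi i, ?_⟩
  rw [integral_finsetSum _ fun i _ => hi i]
  conv_rhs => rw [eq_sum_fin_of_degree_lt hp, map_sum]
  refine Finset.sum_congr rfl fun i _ => ?_
  rw [integral_const_mul, (h i (Nat.lt_succ_iff.1 i.2)).2, map_smul, momentFunctional_X_pow,
    smul_eq_mul]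

lemma IsRepresentingMeasure.momentFunctional_mul_self_nonneg {k : ℕ} {γ : ℕ → ℝ} {μ : Measure ℝ}
    (h : IsRepresentingMeasure (2 * k) γ μ) {p : ℝ[X]} (hp : p.degree < (k + 1 : ℕ)) :
    0 ≤ momentFunctional γ (p * p) := by
  rw [← (h.integrable_integral (degree_mul_self_lt hp)).2]
  exact integral_nonneg fun t => by simpa using mul_self_nonneg (p.eval t)

lemma IsRepresentingMeasure.partiallyPosSemidef {k : ℕ} {β : ℕ → ℝ} {x : ℝ} {μ : Measure ℝ}
    (h : IsRepresentingMeasure (2 * k) (fillGap k β x) μ) :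
    PartiallyPosSemidef (hankel (k + 1) (withGap k β)) := by
  refine ⟨fun i j => by simp [hankel, add_comm], fun Q B hB => ?_⟩
  have hBm : B = momentMatrix (fun i : Q => ((i : Fin (k + 1)) : ℕ)) (fillGap k β x) := by
    ext i j
    have hij := hB i j
    simp only [hankel, Matrix.of_apply, withGap] at hij
    simp only [momentMatrix, Matrix.of_apply, fillGap]
    by_cases hg : ((i : Fin (k + 1)) : ℕ) + ((j : Fin (k + 1)) : ℕ) = 2 * k - 1
    · rw [hg, Function.update_self] at hij
      exact absurd hij (by simp)
    · rw [Function.update_of_ne hg] at hij ⊢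
      exact (Option.some_injective _ hij).symm
  rw [hBm, momentMatrix_posSemidef_iff]
  refine fun y => h.momentFunctional_mul_self_nonneg ?_
  refine (degree_sum_le _ _).trans_lt ((Finset.sup_lt_iff (WithBot.bot_lt_coe _)).2 fun i _ => ?_)
  refine (degree_smul_le _ _).trans_lt ?_
  rw [degree_X_pow]
  exact_mod_cast (i : Fin (k + 1)).2

/-- A polynomial `p` with `∫ p² = 0` vanishes almost everywhere, so every power agrees almost
everywhere with its remainder modulo `p`. -/
lemma IsRepresentingMeasure.exists_remainder {k : ℕ} {γ : ℕ → ℝ} {μ : Measure ℝ}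
    (h : IsRepresentingMeasure (2 * k) γ μ) {p : ℝ[X]} (hp : p ≠ 0)
    (hd : p.degree < k) (h0 : momentFunctional γ (p * p) ≤ 0) {n : ℕ} (hn : n ≤ k) :
    ∃ c : ℝ[X], c.degree < (k - 1 : ℕ) ∧
      ∀ i ≤ k, momentFunctional γ (c * X ^ i) = γ (n + i) := by
  have hpk : p.degree < (k + 1 : ℕ) := hd.trans (by exact_mod_cast Nat.lt_succ_self k)
  obtain ⟨hint, hval⟩ := h.integrable_integral (degree_mul_self_lt hpk)
  have hz : ∫ t, (p * p).eval t ∂μ = 0 :=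
    le_antisymm (hval.le.trans h0)
      (integral_nonneg fun t => by simpa using mul_self_nonneg (p.eval t))
  have hae : ∀ᵐ t ∂μ, p.eval t = 0 := by
    have := (integral_eq_zero_iff_of_nonneg (f := fun t => (p * p).eval t)
      (fun t => by simpa using mul_self_nonneg (p.eval t)) hint).1 hz
    filter_upwards [this] with t ht
    simpa using ht
  have hpk' : p.natDegree ≤ k - 1 := by
    have := (natDegree_lt_iff_degree_lt hp).2 hd
    omega
  have hcd : ((X ^ n : ℝ[X]) % p).degree < (k - 1 : ℕ) :=
    (EuclideanDomain.mod_lt _ hp).trans_le (degree_le_natDegree.trans (by exact_mod_cast hpk'))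
  refine ⟨X ^ n % p, hcd, fun i hi => ?_⟩
  have hlt : ((X ^ n : ℝ[X]) % p * X ^ i).degree < ((2 * k + 1 : ℕ) : WithBot ℕ) := by
    by_cases hc0 : (X ^ n : ℝ[X]) % p = 0
    · rw [hc0, zero_mul, degree_zero]; exact WithBot.bot_lt_coe _
    rw [degree_eq_natDegree hc0] at hcd
    rw [degree_mul, degree_eq_natDegree hc0, degree_X_pow]
    norm_cast at hcd ⊢
    omega
  rw [← (h.integrable_integral hlt).2, ← (h (n + i) (by omega)).2]
  refine integral_congr_ae ?_
  filter_upwards [hae] with t ht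
  have := congrArg (eval t) (EuclideanDomain.mod_add_div (X ^ n : ℝ[X]) p)
  rw [eval_add, eval_mul, ht, zero_mul, add_zero, eval_pow, eval_X] at this
  rw [eval_mul, this, eval_pow, eval_X, pow_add]

/-- If the `k × k` matrix is not positive definite, the remainders of
`IsRepresentingMeasure.exists_remainder` express all columns of both matrices through the
first `k - 1` ones. -/
theorem IsRepresentingMeasure.criterion {k : ℕ} (hk : 1 < k) {β : ℕ → ℝ} {x : ℝ} {μ : Measure ℝ}
    (h : IsRepresentingMeasure (2 * k) (fillGap k β x) μ) :
    (hankel k β).PosDef ∨ ((hankel (k - 1) β).rank = (hankel k β).rank ∧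
      (hankel k β).rank = (borderedHankel k β).rank) := by
  have hH1 : hankel (k - 1) β = hankel (k - 1) (fillGap k β x) := by
    ext i j
    simp only [hankel, Matrix.of_apply, fillGap]
    rw [Function.update_of_ne (by omega)]
  have hBH : borderedHankel k β = borderedHankel k (fillGap k β x) := by
    rw [borderedHankel, borderedHankel, hH1]
    congr 1 <;> ext i j <;> simp only [Matrix.of_apply, fillGap] <;>
      rw [Function.update_of_ne (by omega)]
  rw [← hankel_fillGap hk.le β x, hH1, hBH]
  set γ := fillGap k β x
  refine or_iff_not_imp_left.2 fun hnd => ?_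
  rw [hankel_posDef_iff] at hnd
  push Not at hnd
  obtain ⟨p, hp, hd, h0⟩ := hnd
  have h1 : (hankel (k - 1) γ).rank = (hankel k γ).rank :=
    (rank_hankel_eq_rank_momentMatrix_iff _ γ (Fin.castLE (Nat.sub_le k 1))
      fun _ => rfl).2 fun j => by
      obtain ⟨c, hc, hci⟩ := h.exists_remainder hp hd h0 j.2.le
      exact ⟨c, hc, fun i => hci i i.2.le⟩
  refine ⟨h1, h1.symm.trans ?_⟩
  rw [borderedHankel_eq_momentMatrix]
  have hle : ∀ j : Fin (k - 1) ⊕ Unit,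
      Sum.elim (fun i : Fin (k - 1) => (i : ℕ)) (fun _ : Unit => k) j ≤ k := by
    rintro (j | j)
    · exact j.2.le.trans (Nat.sub_le k 1)
    · exact le_rfl
  exact (rank_hankel_eq_rank_momentMatrix_iff _ γ Sum.inl fun _ => rfl).2 fun j => by
    obtain ⟨c, hc, hci⟩ := h.exists_remainder hp hd h0 (hle j)
    exact ⟨c, hc, fun i => hci _ (hle i)⟩

end HamburgerGap

open HamburgerGap in
theorem theorem3p1 (k : ℕ) (hk : 1 ≤ k) (β : ℕ → ℝ) (hβ : 0 < β 0) :
    List.TFAE [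
      ∃ (x₀ : ℝ) (μ : MeasureTheory.Measure ℝ),
        IsRepresentingMeasure (2 * k) (fillGap k β x₀) μ,
      ∃ (x₀ : ℝ) (μ : MeasureTheory.Measure ℝ),
        IsRepresentingMeasure (2 * k) (fillGap k β x₀) μ ∧ IsAtomicMeasure (seqRank k β) μ,
      PartiallyPosSemidef (hankel (k + 1) (withGap k β)) ∧
        (k = 1 ∨
          (1 < k ∧
            ((hankel k β).PosDef ∨
              ((hankel (k - 1) β).rank = (hankel k β).rank ∧
                (hankel k β).rank = (borderedHankel k β).rank))))] := by
  tfae_have 2 → 1 := fun ⟨x, μ, h, _⟩ => ⟨x, μ, h⟩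
  tfae_have 1 → 3 := fun ⟨x, μ, h⟩ => ⟨h.partiallyPosSemidef, by
    rcases hk.eq_or_lt with h1 | h1
    · exact Or.inl h1.symm
    · exact Or.inr ⟨h1, h.criterion h1⟩⟩
  tfae_have 3 → 2 := by
    rintro ⟨hpsd, rfl | ⟨_, h⟩⟩
    · -- For `k = 1` the matrix `(β 0)` is positive definite.
      refine exists_atomic_of_criterion hk hpsd (Or.inl ?_)
      convert (Matrix.posDef_diagonal_iff (d := fun _ : Fin 1 => β 0)).2 fun _ => hβ using 1
      ext i j
      fin_cases i; fin_cases j; simp [hankel]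
    · exact exists_atomic_of_criterion hk hpsd h
  tfae_finish
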